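/- Let $d\ge 2$ and let $\mu,\nu$ be Borel probability measures on $\mathbb{R}^d$ with finite second moments, with $\mu$ absolutely continuous with respect to Lebesgue measure. For Borel probability measures $\alpha,\beta$ with finite second moments on a Euclidean space, let $$W_2^2(\alpha,\beta)=\inf_{\gamma}\int |x-y|^2\,d\gamma(x,y),$$ the infimum being over all Borel measures $\gamma$ with marginals $\alpha$ and $\beta$. For $\theta\in\mathbb{S}^{d-1}$ let $\mu_\theta$ and $\nu_\theta$ be the images of $\mu$ and $\nu$ under $x\mapsto\theta\cdot x$, let $$SW_2^2(\mu,\nu)=\int_{\mathbb{S}^{d-1}}W_2^2(\mu_\theta,\nu_\theta)\,d\sigma(\theta),$$ where $\sigma$ is the normalized surface measure on $\mathbb{S}^{d-1}$, and let $$\mathcal{D}(\mu,\nu)=\frac1d W_2^2(\mu,\nu)-SW_2^2(\mu,\nu).$$ Let $T=\nabla\varphi$ be the Brenier map from $\mu$ to $\nu$, that is, $T$ pushes $\mu$ forward to $\nu$ and, for $\mu$-almost every $x$, $T(x)$ is the gradient at $x$ of a convex function $\varphi:\mathbb{R}^d\to(-\infty,+\infty]$ that is finite near $x$ and differentiable at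 $x$. Then $\mathcal{D}(\mu,\nu)=0$ if and only if there are $\lambda\ge 0$ and $b\in\mathbb{R}^d$ such that $T(x)=\lambda x+b$ for $\mu$-almost every $x$. -/

import Mathlib

open MeasureTheory
open scoped ENNReal RealInnerProductSpace

noncomputable section

namespace SlicedWasserstein

/-- `γ` is a transport plan (coupling) between `μ` and `ν`: its marginals are `μ` and `ν`. -/
def IsCoupling {E : Type*} [MeasurableSpace E] (γ : Measure (E × E)) (μ ν : Measure E) : Prop :=
  γ.map Prod.fst = μ ∧ γ.map Prod.snd = ν

/-- The squared quadratic Wasserstein distance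
`W₂²(μ, ν) = inf_γ ∫ |x - y|² dγ(x, y)`, the infimum over all transport plans, as an element of
`[0, ∞]`. It is finite when `μ` and `ν` are probability measures with finite second moments. -/
def W2sq {E : Type*} [NormedAddCommGroup E] [MeasurableSpace E] (μ ν : Measure E) : ℝ≥0∞ :=
  ⨅ (γ : Measure (E × E)) (_ : IsCoupling γ μ ν), ∫⁻ p, ‖p.1 - p.2‖ₑ ^ 2 ∂γ

/-- A probability measure with finite second moment. -/
structure IsP2 {E : Type*} [NormedAddCommGroup E] [MeasurableSpace E] (μ : Measure E) : Prop where
  isProbabilityMeasure : IsProbabilityMeasure μ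
  secondMoment_lt_top : ∫⁻ x, ‖x‖ₑ ^ 2 ∂μ < ∞

variable {d : ℕ}

/-- The normalized surface measure on the unit sphere of `ℝ^d`. -/
def sphereUniform (d : ℕ) : Measure (Metric.sphere (0 : EuclideanSpace ℝ (Fin d)) 1) :=
  let s := (volume : Measure (EuclideanSpace ℝ (Fin d))).toSphere
  (s Set.univ)⁻¹ • s

/-- The one-dimensional projection `μ_θ`: the law of `x ↦ θ · x` under `μ`. -/
def proj (θ : EuclideanSpace ℝ (Fin d)) (μ : Measure (EuclideanSpace ℝ (Fin d))) : Measure ℝ :=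
  μ.map (fun x => ⟪θ, x⟫)

/-- The squared sliced Wasserstein distance `SW₂²(μ, ν) = ∫ W₂²(μ_θ, ν_θ) dσ(θ)`, as an element of
`[0, ∞]`. It is finite when `μ` and `ν` are probability measures with finite second moments. -/
def SW2sq (μ ν : Measure (EuclideanSpace ℝ (Fin d))) : ℝ≥0∞ :=
  ∫⁻ θ, W2sq (proj θ.1 μ) (proj θ.1 ν) ∂(sphereUniform d)

/-- The sliced Wasserstein deficit `D(μ, ν) = (1/d) W₂²(μ, ν) - SW₂²(μ, ν)`, a real number (both
terms are finite for probability measures with finite second moments). -/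
def deficit (μ ν : Measure (EuclideanSpace ℝ (Fin d))) : ℝ :=
  (1 / (d : ℝ)) * (W2sq μ ν).toReal - (SW2sq μ ν).toReal

/-- `T` is a Brenier map from `μ` to `ν`: it pushes `μ` forward to `ν` and is `μ`-a.e. the gradient
of a convex function. As usual the convex function may take the value `+∞`; it is therefore given
on an open convex set `Ω` that carries `μ` (the interior of its domain), and the values of `φ`
outside `Ω` play no role. No optimality of `T` is required. -/
structure IsBrenierMap (μ ν : Measure (EuclideanSpace ℝ (Fin d)))
    (T : EuclideanSpace ℝ (Fin d) → EuclideanSpace ℝ (Fin d)) : Prop where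
  aemeasurable : AEMeasurable T μ
  map_eq : μ.map T = ν
  exists_convex_potential :
    ∃ (Ω : Set (EuclideanSpace ℝ (Fin d))) (φ : EuclideanSpace ℝ (Fin d) → ℝ),
      IsOpen Ω ∧ ConvexOn ℝ Ω φ ∧ ∀ᵐ x ∂μ, x ∈ Ω ∧ HasGradientAt φ (T x) x

end SlicedWasserstein

end

/-!
The projections of a coupling `(x, T x)` of `μ` and `ν` are couplings of the projected measures, and
averaging `(θ · v)²` over the sphere gives `|v|² / d` (`lintegral_enorm_inner_sq`, by rotation
invariance). The gradient `T` of a convex function is an optimal map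
(`W2sq_eq_lintegral_of_subgradient`, by duality with the Legendre transform), so the deficit is the
average over `θ` of the gap between the cost of the coupling `(θ · x, θ · T x)` and the optimal cost
in dimension one. It vanishes if and only if almost every one of these couplings is optimal
(`deficit_eq_zero_iff`).

An optimal coupling is monotone on almost all pairs of its points (`ae_inner_nonneg_of_optimal`),
since otherwise exchanging second components lowers the cost. For almost all `x`, `y` and all `θ`
this gives `(θ · (x - y)) (θ · (T x - T y)) ≥ 0`, which forces `T x - T y` to be a nonnegative
multiple of `x - y` (`exists_eq_smul_of_inner_mul_inner_nonneg`). As `μ` does not charge lines, three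
points are almost never collinear, and comparing the three increments shows that the multiple does
not depend on the points (`exists_eq_smul_add_of_ae_parallel`). Conversely, an affine dilation
projects to nondecreasing affine maps of the line, which are derivatives of convex functions and hence
optimal (`W2sq_proj_of_eq_smul_add`).
-/

namespace SlicedWasserstein

open Set
open scoped Pointwise

/-! ### Gradients of convex functions are optimal maps -/

lemma isCoupling_map {α E : Type*} [MeasurableSpace α] [MeasurableSpace E] {ρ : Measure α} {f g : α → E}
    (hf : AEMeasurable f ρ) (hg : AEMeasurable g ρ) :
    IsCoupling (ρ.map fun a => (f a, g a)) (ρ.map f) (ρ.map g) := by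
  constructor
  · rw [AEMeasurable.map_map_of_aemeasurable measurable_fst.aemeasurable (hf.prodMk hg)]; rfl
  · rw [AEMeasurable.map_map_of_aemeasurable measurable_snd.aemeasurable (hf.prodMk hg)]; rfl

lemma enorm_sq_eq_ofReal {F : Type*} [SeminormedAddCommGroup F] (v : F) :
    ‖v‖ₑ ^ 2 = ENNReal.ofReal (‖v‖ ^ 2) := by
  rw [ENNReal.ofReal_pow (norm_nonneg _), ofReal_norm]

/-- A convex function lies above its tangent planes. -/
lemma add_inner_le_of_hasGradientAt {E : Type*} [NormedAddCommGroup E] [InnerProductSpace ℝ E]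
    [CompleteSpace E] {Ω : Set E} {φ : E → ℝ} {x v z : E}
    (hφ : ConvexOn ℝ Ω φ) (hx : x ∈ Ω) (hz : z ∈ Ω) (hv : HasGradientAt φ v x) :
    φ x + ⟪v, z - x⟫ ≤ φ z := by
  have hconv := hφ.comp_affineMap (AffineMap.lineMap x z : ℝ →ᵃ[ℝ] E)
  have hder : HasDerivAt (φ ∘ (AffineMap.lineMap x z : ℝ →ᵃ[ℝ] E)) ⟪v, z - x⟫ 0 := by
    have h0 : HasFDerivAt φ (InnerProductSpace.toDual ℝ E v)
        ((AffineMap.lineMap x z : ℝ →ᵃ[ℝ] E) 0) := by simpa using hv.hasFDerivAt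
    simpa using h0.comp_hasDerivAt 0 (AffineMap.hasDerivAt_lineMap (a := x) (b := z))
  have := hconv.le_slope_of_hasDerivAt (x := 0) (y := 1) (by simpa using hx) (by simpa using hz)
    one_pos hder
  simp [slope_def_field] at this
  linarith

lemma W2sq_le_of_isCoupling {E : Type*} [NormedAddCommGroup E] [MeasurableSpace E]
    {μ ν : Measure E} {γ : Measure (E × E)} (hγ : IsCoupling γ μ ν) :
    W2sq μ ν ≤ ∫⁻ p, ‖p.1 - p.2‖ₑ ^ 2 ∂γ :=
  iInf₂_le (f := fun (γ : Measure (E × E)) (_ : IsCoupling γ μ ν) =>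
    ∫⁻ p, ‖p.1 - p.2‖ₑ ^ 2 ∂γ) γ hγ

/-- The easy half of Kantorovich duality. -/
lemma ofReal_integral_add_integral_le {E : Type*} [NormedAddCommGroup E] [MeasurableSpace E]
    {μ ν : Measure E} {γ : Measure (E × E)} (hγ : IsCoupling γ μ ν)
    {F G : E → ℝ} (hF : Integrable F μ) (hG : Integrable G ν)
    (hFG : ∀ᵐ p ∂γ, F p.1 + G p.2 ≤ ‖p.1 - p.2‖ ^ 2) :
    ENNReal.ofReal (∫ x, F x ∂μ + ∫ y, G y ∂ν) ≤ ∫⁻ p, ‖p.1 - p.2‖ₑ ^ 2 ∂γ := by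
  obtain ⟨rfl, rfl⟩ := hγ
  have hF' : Integrable (fun p : E × E => F p.1) γ := hF.comp_measurable measurable_fst
  have hG' : Integrable (fun p : E × E => G p.2) γ := hG.comp_measurable measurable_snd
  rw [integral_map measurable_fst.aemeasurable hF.1, integral_map measurable_snd.aemeasurable hG.1,
    ← integral_add hF' hG']
  refine (ENNReal.ofReal_le_ofReal (integral_mono_ae ?_ ?_ (?_ : _ ≤ᵐ[γ]
    fun p => max (F p.1 + G p.2) 0))).trans ?_
  · exact hF'.add hG'
  · exact (hF'.add hG').pos_part
  · exact .of_forall fun p => le_max_left _ _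
  · rw [ofReal_integral_eq_lintegral_ofReal]
    · refine lintegral_mono_ae ?_
      filter_upwards [hFG] with p hp
      rw [enorm_sq_eq_ofReal]
      exact ENNReal.ofReal_le_ofReal (max_le hp (sq_nonneg _))
    · exact (hF'.add hG').pos_part
    · exact .of_forall fun p => le_max_right _ _

section Optimality

variable {E : Type*} [NormedAddCommGroup E] [MeasurableSpace E] [BorelSpace E]
  [SecondCountableTopology E] {μ ν : Measure E}

lemma IsP2.memLp_id (hμ : IsP2 μ) : MemLp (fun x : E => x) 2 μ := by
  refine ⟨aestronglyMeasurable_id, ?_⟩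
  rw [eLpNorm_lt_top_iff_lintegral_rpow_enorm_lt_top (by norm_num) (by norm_num)]
  simpa using hμ.secondMoment_lt_top

lemma measurable_enorm_sub_sq : Measurable fun p : E × E => ‖p.1 - p.2‖ₑ ^ 2 :=
  (measurable_fst.sub measurable_snd).enorm.pow_const 2

lemma W2sq_map_le {α : Type*} [MeasurableSpace α] {ρ : Measure α} {f g : α → E}
    (hf : AEMeasurable f ρ) (hg : AEMeasurable g ρ) :
    W2sq (ρ.map f) (ρ.map g) ≤ ∫⁻ a, ‖f a - g a‖ₑ ^ 2 ∂ρ := by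
  refine (W2sq_le_of_isCoupling (isCoupling_map hf hg)).trans ?_
  rw [lintegral_map' measurable_enorm_sub_sq.aemeasurable (hf.prodMk hg)]

variable [InnerProductSpace ℝ E]

/-- A map that selects subgradients of a function `φ` is an optimal transport map. The dual
potential is the Legendre transform `ψ y = sup_z ⟪z, y⟫ - φ z`; its supremum is taken over a dense
sequence of `Ω`, which makes it measurable. -/
theorem W2sq_eq_lintegral_of_subgradient (hμ : IsP2 μ) (hν : IsP2 ν) {T : E → E}
    (hTm : AEMeasurable T μ) (hTν : μ.map T = ν) {Ω : Set E} {φ : E → ℝ} (hΩ : MeasurableSet Ω)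
    (hφ : ContinuousOn φ Ω)
    (hsub : ∀ᵐ x ∂μ, x ∈ Ω ∧ ∀ z ∈ Ω, φ x + ⟪T x, z - x⟫ ≤ φ z) :
    W2sq μ ν = ∫⁻ x, ‖x - T x‖ₑ ^ 2 ∂μ := by
  have := hμ.isProbabilityMeasure
  have hidμ := hμ.memLp_id
  have hT2 : MemLp T 2 μ := (memLp_map_measure_iff (g := fun y : E => y)
    aestronglyMeasurable_id hTm).1 (hTν ▸ hν.memLp_id)
  have hid1 : Integrable (fun x : E => x) μ := hidμ.integrable (by norm_num)
  have hT1 : Integrable T μ := hT2.integrable (by norm_num)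
  have hinner : Integrable (fun x => ⟪x, T x⟫) μ := by
    refine (((hidμ.norm.integrable_sq.add hT2.norm.integrable_sq).sub
      (hidμ.sub hT2).norm.integrable_sq).div_const 2).congr (.of_forall fun x => ?_)
    simp only [Pi.sub_apply, Pi.add_apply]
    rw [norm_sub_sq_real]
    ring
  refine le_antisymm ?_ ?_
  · have := W2sq_map_le (ρ := μ) (f := fun x => x) aemeasurable_id hTm
    rwa [hTν, Measure.map_id'] at this
  obtain ⟨x₀, hx₀, hx₀'⟩ := hsub.exists
  have : Nonempty Ω := ⟨⟨x₀, hx₀⟩⟩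
  set u : ℕ → Ω := TopologicalSpace.denseSeq Ω
  set g : ℕ → E → ℝ := fun n y => ⟪(u n : E), y⟫ - φ (u n)
  have hgm : ∀ n, Measurable (g n) := fun n => by
    have : Continuous (g n) := by fun_prop
    exact this.measurable
  set ψ : E → ℝ := fun y => ⨆ n, g n y
  have hψm : Measurable ψ := Measurable.iSup hgm
  set B : Set E := {y | BddAbove (range fun n => g n y)}
  have hBm : MeasurableSet B := measurableSet_bddAbove_range hgm
  -- the Fenchel inequality, extended from the dense sequence to `Ω` by continuity
  have hfenchel : ∀ z ∈ Ω, ∀ y ∈ B, ⟪z, y⟫ ≤ φ z + ψ y := by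
    intro z hz y hy
    have hcl : IsClosed {z : Ω | ⟪(z : E), y⟫ - φ z ≤ ψ y} := by
      refine isClosed_le ?_ continuous_const
      exact (continuous_subtype_val.inner continuous_const).sub
        (continuousOn_iff_continuous_domRestrict.1 hφ)
    have := (TopologicalSpace.denseRange_denseSeq Ω).induction_on
      (p := fun z : Ω => ⟪(z : E), y⟫ - φ z ≤ ψ y) ⟨z, hz⟩ hcl (fun n => le_ciSup hy n)
    simp only at this
    linarith
  have hgT : ∀ᵐ x ∂μ, x ∈ Ω ∧ T x ∈ B ∧ φ x + ψ (T x) = ⟪x, T x⟫ := by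
    filter_upwards [hsub] with x ⟨hx, hx'⟩
    have hle : ∀ n, g n (T x) ≤ ⟪x, T x⟫ - φ x := fun n => by
      have := hx' (u n) (u n).2
      rw [inner_sub_right, real_inner_comm, real_inner_comm x] at this
      simp only [g]
      linarith
    have hB : T x ∈ B := ⟨_, by rintro _ ⟨n, rfl⟩; exact hle n⟩
    refine ⟨hx, hB, le_antisymm ?_ (hfenchel x hx _ hB)⟩
    have : ψ (T x) ≤ ⟪x, T x⟫ - φ x := ciSup_le hle
    linarith
  have hBν : ∀ᵐ y ∂ν, y ∈ B := by
    rw [← hTν]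
    refine (ae_map_iff (p := fun y => y ∈ B) hTm hBm).2 ?_
    exact hgT.mono fun x hx => hx.2.1
  have hφm : AEStronglyMeasurable φ μ := by
    have h := hφ.aemeasurable (μ := μ) hΩ
    rw [Measure.restrict_eq_self_of_ae_mem (hgT.mono fun x hx => hx.1)] at h
    exact h.aestronglyMeasurable
  -- an affine minorant of `φ` and one of `ψ` bound `φ` from both sides by integrable functions
  have hφi : Integrable φ μ := by
    refine integrable_of_le_of_le hφm (g₁ := fun x => φ x₀ + ⟪T x₀, x - x₀⟫)
      (g₂ := fun x => ⟪x, T x⟫ - ⟪x₀, T x⟫ + φ x₀) ?_ ?_ ?_ ?_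
    · filter_upwards [hgT] with x hx using hx₀' x hx.1
    · filter_upwards [hgT] with x hx
      have := hfenchel x₀ hx₀ _ hx.2.1
      have := hx.2.2
      linarith
    · exact (integrable_const _).add ((hid1.sub (integrable_const _)).const_inner _)
    · exact (hinner.sub (hT1.const_inner _)).add (integrable_const _)
  have hψTi : Integrable (fun x => ψ (T x)) μ := by
    refine (hinner.sub hφi).congr ?_
    filter_upwards [hgT] with x hx
    have := hx.2.2
    simp only [Pi.sub_apply]
    linarith
  have hψi : Integrable ψ ν := by
    rw [← hTν]
    exact (integrable_map_measure hψm.aestronglyMeasurable hTm).2 hψTi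
  have hF : Integrable (fun x => ‖x‖ ^ 2 - 2 * φ x) μ :=
    hidμ.norm.integrable_sq.sub (hφi.const_mul 2)
  have hG : Integrable (fun y => ‖y‖ ^ 2 - 2 * ψ y) ν :=
    hν.memLp_id.norm.integrable_sq.sub (hψi.const_mul 2)
  have hval : ∫⁻ x, ‖x - T x‖ₑ ^ 2 ∂μ =
      ENNReal.ofReal (∫ x, (‖x‖ ^ 2 - 2 * φ x) ∂μ + ∫ y, (‖y‖ ^ 2 - 2 * ψ y) ∂ν) := by
    have hG' := hG
    rw [← hTν] at hG' ⊢
    have hGT : Integrable (fun x => ‖T x‖ ^ 2 - 2 * ψ (T x)) μ := hG'.comp_aemeasurable hTm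
    rw [integral_map hTm hG'.1, ← integral_add hF hGT]
    have : (fun x => ‖x‖ ^ 2 - 2 * φ x + (‖T x‖ ^ 2 - 2 * ψ (T x))) =ᵐ[μ]
        fun x => ‖x - T x‖ ^ 2 := by
      filter_upwards [hgT] with x hx
      rw [norm_sub_sq_real, ← hx.2.2]
      ring
    rw [integral_congr_ae this, ofReal_integral_eq_lintegral_ofReal]
    · simp only [enorm_sq_eq_ofReal]
    · exact (hidμ.sub hT2).norm.integrable_sq
    · exact .of_forall fun x => sq_nonneg _
  rw [hval]
  refine le_iInf₂ fun γ hγ => ofReal_integral_add_integral_le hγ hF hG ?_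
  have h1 : ∀ᵐ p ∂γ, p.1 ∈ Ω := by
    refine ae_of_ae_map (p := fun x => x ∈ Ω) measurable_fst.aemeasurable ?_
    rw [hγ.1]; exact hgT.mono fun x hx => hx.1
  have h2 : ∀ᵐ p ∂γ, p.2 ∈ B := by
    refine ae_of_ae_map (p := fun x => x ∈ B) measurable_snd.aemeasurable ?_
    rwa [hγ.2]
  filter_upwards [h1, h2] with p hp1 hp2
  rw [norm_sub_sq_real]
  have := hfenchel _ hp1 _ hp2
  linarith

end Optimality

/-! ### Optimal couplings are monotone -/

lemma enorm_sq_add_enorm_sq_lt {E : Type*} [NormedAddCommGroup E] [InnerProductSpace ℝ E]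
    {x y x' y' : E} (h : ⟪x - x', y - y'⟫ < 0) :
    ‖x - y'‖ₑ ^ 2 + ‖x' - y‖ₑ ^ 2 < ‖x - y‖ₑ ^ 2 + ‖x' - y'‖ₑ ^ 2 := by
  simp only [enorm_sq_eq_ofReal]
  rw [← ENNReal.ofReal_add (sq_nonneg _) (sq_nonneg _),
    ← ENNReal.ofReal_add (sq_nonneg _) (sq_nonneg _)]
  have : ‖x - y'‖ ^ 2 + ‖x' - y‖ ^ 2 < ‖x - y‖ ^ 2 + ‖x' - y'‖ ^ 2 := by
    simp only [inner_sub_left, inner_sub_right, norm_sub_sq_real] at h ⊢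
    linarith
  exact (ENNReal.ofReal_lt_ofReal_iff (lt_of_le_of_lt (by positivity) this)).2 this

section Monotonicity

variable {E : Type*} [NormedAddCommGroup E] [MeasurableSpace E] [BorelSpace E]
  [SecondCountableTopology E] [InnerProductSpace ℝ E] {μ ν : Measure E}

/-- The support of an optimal plan `γ` is monotone, up to null sets. The competitor draws two
independent pairs from `γ` and exchanges their second components on the set `A` of pairs that
violate monotonicity. As `A` is symmetric, the exchange keeps both marginals, and it lowers the
cost unless `A` is a null set. -/
theorem ae_inner_nonneg_of_optimal {γ : Measure (E × E)} [IsProbabilityMeasure γ]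
    (hγ : IsCoupling γ μ ν) (hopt : ∫⁻ p, ‖p.1 - p.2‖ₑ ^ 2 ∂γ ≤ W2sq μ ν)
    (hfin : ∫⁻ p, ‖p.1 - p.2‖ₑ ^ 2 ∂γ ≠ ∞) :
    ∀ᵐ q ∂γ.prod γ, 0 ≤ ⟪q.1.1 - q.2.1, q.1.2 - q.2.2⟫ := by
  classical
  set P := γ.prod γ
  set A : Set ((E × E) × (E × E)) := {q | ⟪q.1.1 - q.2.1, q.1.2 - q.2.2⟫ < 0}
  have hA : MeasurableSet A := by
    have : IsOpen A := isOpen_lt (by fun_prop) continuous_const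
    exact this.measurableSet
  have hAswap : Prod.swap ⁻¹' A = A := by
    ext q
    simp only [A, mem_preimage, mem_ofPred_eq, Prod.fst_swap, Prod.snd_swap]
    rw [← neg_sub q.1.1, ← neg_sub q.1.2, inner_neg_neg]
  have hswap : ∀ h : (E × E) × (E × E) → ℝ≥0∞, ∫⁻ q in A, h q.swap ∂P = ∫⁻ q in A, h q ∂P := by
    intro h
    have := (Measure.measurePreserving_swap (μ := γ) (ν := γ)).setLIntegral_comp_preimage_emb
      MeasurableEquiv.prodComm.measurableEmbedding h A
    rwa [hAswap] at this
  set Φ : (E × E) × (E × E) → E × E := fun q => if q ∈ A then (q.1.1, q.2.2) else q.1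
  have hΦ : Measurable Φ := Measurable.ite hA (by fun_prop) (by fun_prop)
  have hsplit : ∀ h : E × E → ℝ≥0∞, ∫⁻ q, h (Φ q) ∂P =
      ∫⁻ q in A, h (q.1.1, q.2.2) ∂P + ∫⁻ q in Aᶜ, h q.1 ∂P := by
    intro h
    rw [← lintegral_add_compl _ hA]
    congr 1
    · exact setLIntegral_congr_fun hA fun q hq => by simp only [Φ, if_pos hq]
    · exact setLIntegral_congr_fun hA.compl fun q hq => by simp only [Φ, if_neg hq]
  have hfstP : P.map Prod.fst = γ := by simp [P, Measure.map_fst_prod]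
  have hcoup : IsCoupling (P.map Φ) μ ν := by
    constructor
    · rw [Measure.map_map measurable_fst hΦ]
      have : Prod.fst ∘ Φ = Prod.fst ∘ Prod.fst := by
        funext q; simp only [Φ, Function.comp_apply]; split_ifs <;> rfl
      rw [this, ← Measure.map_map measurable_fst measurable_fst, hfstP, hγ.1]
    · refine Measure.ext_of_lintegral _ fun f hf => ?_
      have hswapf : ∫⁻ q in A, f q.2.2 ∂P = ∫⁻ q in A, f q.1.2 ∂P := hswap fun q => f q.1.2
      rw [lintegral_map hf measurable_snd, lintegral_map (by fun_prop) hΦ,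
        hsplit fun p => f p.2, hswapf, lintegral_add_compl _ hA, ← hγ.2,
        lintegral_map hf measurable_snd, ← hfstP, lintegral_map (by fun_prop) measurable_fst]
  have hγP : ∫⁻ q, ‖q.1.1 - q.1.2‖ₑ ^ 2 ∂P = ∫⁻ p, ‖p.1 - p.2‖ₑ ^ 2 ∂γ := by
    rw [← hfstP, lintegral_map measurable_enorm_sub_sq measurable_fst]
  have hle : ∫⁻ q in A, ‖q.1.1 - q.1.2‖ₑ ^ 2 ∂P ≤ ∫⁻ q in A, ‖q.1.1 - q.2.2‖ₑ ^ 2 ∂P := by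
    have h : ∫⁻ q, ‖q.1.1 - q.1.2‖ₑ ^ 2 ∂P ≤ ∫⁻ q, ‖(Φ q).1 - (Φ q).2‖ₑ ^ 2 ∂P := by
      rw [hγP, ← lintegral_map measurable_enorm_sub_sq hΦ]
      exact hopt.trans (W2sq_le_of_isCoupling hcoup)
    rw [hsplit fun p => ‖p.1 - p.2‖ₑ ^ 2, ← lintegral_add_compl _ hA] at h
    refine (ENNReal.add_le_add_iff_right ?_).1 h
    exact ne_top_of_le_ne_top (hγP ▸ hfin) (setLIntegral_le_lintegral _ _)
  have hswap₁ : ∫⁻ q in A, ‖q.2.1 - q.2.2‖ₑ ^ 2 ∂P = ∫⁻ q in A, ‖q.1.1 - q.1.2‖ₑ ^ 2 ∂P :=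
    hswap fun q => ‖q.1.1 - q.1.2‖ₑ ^ 2
  have hswap₂ : ∫⁻ q in A, ‖q.2.1 - q.1.2‖ₑ ^ 2 ∂P = ∫⁻ q in A, ‖q.1.1 - q.2.2‖ₑ ^ 2 ∂P :=
    hswap fun q => ‖q.1.1 - q.2.2‖ₑ ^ 2
  have hmeas : Measurable fun q : (E × E) × (E × E) => ‖q.1.1 - q.1.2‖ₑ ^ 2 :=
    measurable_enorm_sub_sq.comp measurable_fst
  have hmeas' : Measurable fun q : (E × E) × (E × E) => ‖q.2.1 - q.2.2‖ₑ ^ 2 :=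
    measurable_enorm_sub_sq.comp measurable_snd
  have hmeas'' : Measurable fun q : (E × E) × (E × E) => ‖q.1.1 - q.2.2‖ₑ ^ 2 :=
    measurable_enorm_sub_sq.comp (f := fun q : (E × E) × (E × E) => (q.1.1, q.2.2)) (by fun_prop)
  -- by symmetry of `A`, the comparison on `A` may be made after averaging over the exchange
  have hsum : ∫⁻ q in A, (‖q.1.1 - q.1.2‖ₑ ^ 2 + ‖q.2.1 - q.2.2‖ₑ ^ 2) ∂P ≤
      ∫⁻ q in A, (‖q.1.1 - q.2.2‖ₑ ^ 2 + ‖q.2.1 - q.1.2‖ₑ ^ 2) ∂P := by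
    rw [lintegral_add_left hmeas, lintegral_add_left hmeas'', hswap₁, hswap₂]
    exact add_le_add hle hle
  have hsumfin : ∫⁻ q in A, (‖q.1.1 - q.1.2‖ₑ ^ 2 + ‖q.2.1 - q.2.2‖ₑ ^ 2) ∂P ≠ ∞ := by
    rw [lintegral_add_left hmeas, hswap₁]
    have := ne_top_of_le_ne_top (hγP ▸ hfin)
      (setLIntegral_le_lintegral A fun q => ‖q.1.1 - q.1.2‖ₑ ^ 2)
    exact ENNReal.add_ne_top.2 ⟨this, this⟩
  have hlt : ∀ᵐ q ∂P.restrict A, ‖q.1.1 - q.2.2‖ₑ ^ 2 + ‖q.2.1 - q.1.2‖ₑ ^ 2 <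
      ‖q.1.1 - q.1.2‖ₑ ^ 2 + ‖q.2.1 - q.2.2‖ₑ ^ 2 := by
    filter_upwards [ae_restrict_mem hA] with q hq using enorm_sq_add_enorm_sq_lt hq
  have hle' := hlt.mono fun q hq => hq.le
  have heq := ae_eq_of_ae_le_of_lintegral_le hle'
    (ne_top_of_le_ne_top hsumfin (lintegral_mono_ae hle')) (hmeas.add hmeas').aemeasurable hsum
  have hfalse : ∀ᵐ q ∂P.restrict A, False := by
    filter_upwards [hlt, heq] with q h1 h2 using h1.ne h2
  rw [ae_restrict_iff' hA] at hfalse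
  filter_upwards [hfalse] with q hq using not_lt.1 hq

end Monotonicity

/-! ### Second moments of the uniform measure on the sphere -/

section Sphere

variable {d : ℕ}

lemma isProbabilityMeasure_sphereUniform (hd : d ≠ 0) : IsProbabilityMeasure (sphereUniform d) := by
  have : NeZero d := ⟨hd⟩
  constructor
  rw [sphereUniform, Measure.smul_apply, smul_eq_mul]
  refine ENNReal.inv_mul_cancel ?_ (measure_ne_top _ _)
  rw [Ne, Measure.measure_univ_eq_zero]
  exact Measure.toSphere_ne_zero _

lemma isOpenPosMeasure_sphereUniform : (sphereUniform d).IsOpenPosMeasure :=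
  Measure.isOpenPosMeasure_smul _ (ENNReal.inv_ne_zero.2 (measure_ne_top _ _))

/-- The action of a linear isometry on the unit sphere. -/
noncomputable def sphereMap (L : EuclideanSpace ℝ (Fin d) ≃ₗᵢ[ℝ] EuclideanSpace ℝ (Fin d))
    (θ : Metric.sphere (0 : EuclideanSpace ℝ (Fin d)) 1) :
    Metric.sphere (0 : EuclideanSpace ℝ (Fin d)) 1 :=
  ⟨L θ, by simp⟩

lemma measurable_sphereMap (L : EuclideanSpace ℝ (Fin d) ≃ₗᵢ[ℝ] EuclideanSpace ℝ (Fin d)) :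
    Measurable (sphereMap L) :=
  ((L.continuous.comp continuous_subtype_val).subtype_mk _).measurable

lemma measurePreserving_sphereMap
    (L : EuclideanSpace ℝ (Fin d) ≃ₗᵢ[ℝ] EuclideanSpace ℝ (Fin d)) :
    MeasurePreserving (sphereMap L) (sphereUniform d) (sphereUniform d) := by
  refine MeasurePreserving.smul_measure ⟨measurable_sphereMap L, ?_⟩ _
  ext s hs
  rw [Measure.map_apply (measurable_sphereMap L) hs,
    Measure.toSphere_apply' _ (measurable_sphereMap L hs), Measure.toSphere_apply' _ hs]
  congr 1
  have hpre : Ioo (0 : ℝ) 1 • ((↑) '' (sphereMap L ⁻¹' s) : Set (EuclideanSpace ℝ (Fin d))) =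
      L ⁻¹' (Ioo (0 : ℝ) 1 • ((↑) '' s)) := by
    ext x
    simp only [mem_smul, mem_image, mem_preimage]
    constructor
    · rintro ⟨r, hr, _, ⟨θ, hθ, rfl⟩, rfl⟩
      exact ⟨r, hr, _, ⟨_, hθ, rfl⟩, by simp [sphereMap]⟩
    · rintro ⟨r, hr, _, ⟨θ, hθ, rfl⟩, hx⟩
      refine ⟨r, hr, _, ⟨sphereMap L.symm θ, ?_, rfl⟩, ?_⟩
      · simpa [sphereMap] using hθ
      · apply L.injective
        simpa [sphereMap] using hx
  rw [hpre]
  exact L.measurePreserving.measure_preimage_emb L.toHomeomorph.measurableEmbedding _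

/-- The second moments of the uniform measure on the sphere. By rotation invariance the integral
depends on the norm of `v` only, and its values on an orthonormal basis add up to `1`. -/
lemma lintegral_enorm_inner_sq (hd : d ≠ 0) (v : EuclideanSpace ℝ (Fin d)) :
    ∫⁻ θ, ‖⟪θ.1, v⟫‖ₑ ^ 2 ∂(sphereUniform d) = ‖v‖ₑ ^ 2 / d := by
  have := isProbabilityMeasure_sphereUniform hd
  set Q : EuclideanSpace ℝ (Fin d) → ℝ≥0∞ := fun v => ∫⁻ θ, ‖⟪θ.1, v⟫‖ₑ ^ 2 ∂(sphereUniform d)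
  have hmeas : ∀ v : EuclideanSpace ℝ (Fin d), Measurable
      fun θ : Metric.sphere (0 : EuclideanSpace ℝ (Fin d)) 1 => ‖⟪θ.1, v⟫‖ₑ ^ 2 := fun v => by
    have : Continuous fun θ : Metric.sphere (0 : EuclideanSpace ℝ (Fin d)) 1 => ⟪θ.1, v⟫ := by
      fun_prop
    exact this.measurable.enorm.pow_const 2
  have hinv : ∀ v w, ‖v‖ = ‖w‖ → Q v = Q w := by
    intro v w h
    set L := Submodule.reflection (Submodule.span ℝ {v - w})ᗮ
    have hL : L v = w := Submodule.reflection_sub h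
    rw [← hL]
    simp only [Q]
    rw [← (measurePreserving_sphereMap L).lintegral_comp (hmeas (L v))]
    simp [sphereMap]
  have hsmul : ∀ (r : ℝ) v, Q (r • v) = ‖r‖ₑ ^ 2 * Q v := by
    intro r v
    simp only [Q, inner_smul_right, enorm_mul, mul_pow]
    exact lintegral_const_mul _ (hmeas v)
  have hsum : ∀ i : Fin d, Q (EuclideanSpace.single i 1) * d = 1 := by
    intro i
    have h1 : ∑ j : Fin d, Q (EuclideanSpace.single j 1) = 1 := by
      simp only [Q]
      rw [← lintegral_finsetSum _ fun j _ => hmeas _]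
      have : ∀ θ : Metric.sphere (0 : EuclideanSpace ℝ (Fin d)) 1,
          ∑ j : Fin d, ‖⟪θ.1, EuclideanSpace.single j (1 : ℝ)⟫‖ₑ ^ 2 = 1 := by
        intro θ
        simp only [enorm_sq_eq_ofReal]
        rw [← ENNReal.ofReal_sum_of_nonneg fun _ _ => sq_nonneg _]
        have h2 : ‖θ.1‖ ^ 2 = 1 := by simp
        rw [EuclideanSpace.norm_sq_eq] at h2
        simp only [Real.norm_eq_abs, sq_abs] at h2
        simp [EuclideanSpace.inner_single_right, h2]
      simp [this]
    rw [Finset.sum_congr rfl fun j _ => hinv _ (EuclideanSpace.single i 1) (by simp)] at h1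
    simpa [mul_comm] using h1
  have hd0 : (d : ℝ≥0∞) ≠ 0 := by exact_mod_cast hd
  let i : Fin d := ⟨0, Nat.pos_of_ne_zero hd⟩
  change Q v = _
  rw [hinv v (‖v‖ • EuclideanSpace.single i 1) (by simp [norm_smul]), hsmul, enorm_norm,
    ENNReal.eq_div_iff hd0 (ENNReal.natCast_ne_top d), mul_comm, mul_assoc, hsum, mul_one]

end Sphere

/-! ### Maps with parallel increments -/

section Rigidity

variable {E : Type*} [NormedAddCommGroup E] [InnerProductSpace ℝ E]

/-- A quadratic form `θ ↦ ⟪θ, u⟫ * ⟪θ, v⟫` is nonnegative only if `v` is a nonnegative multiple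
of `u`. -/
lemma exists_eq_smul_of_inner_mul_inner_nonneg {u v : E} (hu : u ≠ 0)
    (h : ∀ θ : E, ‖θ‖ = 1 → 0 ≤ ⟪θ, u⟫ * ⟪θ, v⟫) : ∃ c : ℝ, 0 ≤ c ∧ v = c • u := by
  have h' : ∀ θ : E, 0 ≤ ⟪θ, u⟫ * ⟪θ, v⟫ := by
    intro θ
    rcases eq_or_ne θ 0 with rfl | hθ
    · simp
    have hpos : 0 < ‖θ‖ := norm_pos_iff.2 hθ
    have := h (‖θ‖⁻¹ • θ) (by simp [norm_smul, hpos.ne'])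
    rw [real_inner_smul_left, real_inner_smul_left] at this
    have h2 : 0 ≤ (‖θ‖⁻¹ * ‖θ‖⁻¹) * (⟪θ, u⟫ * ⟪θ, v⟫) := by linarith
    exact (mul_nonneg_iff_of_pos_left (by positivity)).1 h2
  have huu : 0 < ⟪u, u⟫ := real_inner_self_pos.2 hu
  have hc : 0 ≤ ⟪u, v⟫ := (mul_nonneg_iff_of_pos_left huu).1 (h' u)
  refine ⟨⟪u, v⟫ / ⟪u, u⟫, by positivity, ?_⟩
  set w := v - (⟪u, v⟫ / ⟪u, u⟫) • u with hw
  have hwu : ⟪w, u⟫ = 0 := by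
    rw [hw, inner_sub_left, real_inner_smul_left, real_inner_comm]
    field_simp
    ring
  have hwv : ⟪w, v⟫ = ⟪w, w⟫ := by
    conv_rhs => rw [hw, inner_sub_right, real_inner_smul_right, ← hw, hwu]
    ring
  -- test directions `w - t • u` with `t` tending to `0` from above
  have hle : ∀ t : ℝ, 0 < t → ⟪w, w⟫ ≤ t * ⟪u, v⟫ := by
    intro t ht
    have := h' (w - t • u)
    rw [inner_sub_left w, inner_sub_left w, real_inner_smul_left, real_inner_smul_left, hwu, hwv,
      zero_sub, neg_mul] at this
    have h2 : t * ⟪u, u⟫ * (⟪w, w⟫ - t * ⟪u, v⟫) ≤ 0 := by linarith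
    have h3 := nonpos_of_mul_nonpos_right h2 (by positivity)
    linarith
  have hw0 : ⟪w, w⟫ ≤ 0 := by
    refine le_of_forall_pos_le_add fun ε hε => ?_
    have := hle (ε / (⟪u, v⟫ + 1)) (by positivity)
    refine this.trans ?_
    rw [zero_add, div_mul_eq_mul_div, div_le_iff₀ (by positivity)]
    nlinarith
  exact sub_eq_zero.1 (real_inner_self_nonpos.1 hw0)

/-- If the increments of `f` between three points that are not collinear are parallel to the
increments of the points, then all three ratios agree. -/
lemma ratio_eq_of_not_collinear {x y z fx fy fz : E} {a b c : ℝ}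
    (hne : x ≠ y) (hz : z ∉ line[ℝ, x, y]) (hxy : fx - fy = c • (x - y)) (hxz : fx - fz = a • (x - z))
    (hyz : fy - fz = b • (y - z)) : a = c := by
  by_contra hac
  have key : (a - b) • (z - x) = (c - b) • (y - x) := by
    have h : c • (x - y) + b • (y - z) = a • (x - z) := by rw [← hxy, ← hyz, ← hxz]; abel
    rw [← sub_eq_zero] at h ⊢
    rw [← h]
    module
  rcases eq_or_ne a b with rfl | hab
  · rw [sub_self, zero_smul, eq_comm, smul_eq_zero] at key
    rcases key with h | h
    · exact hac (sub_eq_zero.1 h).symm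
    · exact hne (sub_eq_zero.1 h).symm
  · apply hz
    have : z = AffineMap.lineMap x y ((a - b)⁻¹ * (c - b)) := by
      rw [AffineMap.lineMap_apply_module', mul_smul, ← key, inv_smul_smul₀ (sub_ne_zero.2 hab)]
      simp
    rw [this]
    exact AffineMap.lineMap_mem_affineSpan_pair _ _ _

variable [FiniteDimensional ℝ E] [MeasurableSpace E] [BorelSpace E]

lemma ae_notMem_line {μ m : Measure E} [m.IsAddHaarMeasure] (hac : μ ≪ m)
    (hd : 2 ≤ Module.finrank ℝ E) (x y : E) : ∀ᵐ z ∂μ, z ∉ line[ℝ, x, y] := by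
  refine hac.ae_le (measure_eq_zero_iff_ae_notMem.1 (Measure.addHaar_affineSubspace m _ ?_))
  intro htop
  have h1 := collinear_iff_finrank_le_one.1 (collinear_pair ℝ x y)
  have h2 : Module.finrank ℝ (vectorSpan ℝ ({x, y} : Set E)) = Module.finrank ℝ E := by
    rw [← direction_affineSpan, htop, AffineSubspace.direction_top, finrank_top]
  omega

/-- A map whose increments are almost everywhere parallel to the increments of the points is an
affine dilation, as three points are almost never collinear. -/
theorem exists_eq_smul_add_of_ae_parallel {μ m : Measure E} [m.IsAddHaarMeasure]
    [IsProbabilityMeasure μ] (hac : μ ≪ m) (hd : 2 ≤ Module.finrank ℝ E) {T : E → E}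
    (h : ∀ᵐ x ∂μ, ∀ᵐ y ∂μ, x ≠ y → ∃ c : ℝ, 0 ≤ c ∧ T x - T y = c • (x - y)) :
    ∃ (l : ℝ) (b : E), 0 ≤ l ∧ ∀ᵐ x ∂μ, T x = l • x + b := by
  obtain ⟨x, hx⟩ := h.exists
  obtain ⟨y, hy, hyx, hxy⟩ := (h.and ((ae_notMem_line hac hd x x).and hx)).exists
  have hne : x ≠ y := by
    rintro rfl
    exact hyx (left_mem_affineSpan_pair ℝ _ _)
  obtain ⟨c, hc, hcxy⟩ := hxy hne
  refine ⟨c, T x - c • x, hc, ?_⟩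
  filter_upwards [hx, hy, ae_notMem_line hac hd x y] with z hxz hyz hz
  obtain ⟨a, -, ha⟩ := hxz (by rintro rfl; exact hz (left_mem_affineSpan_pair ℝ _ _))
  obtain ⟨b, -, hb⟩ := hyz (by rintro rfl; exact hz (right_mem_affineSpan_pair ℝ _ _))
  rw [ratio_eq_of_not_collinear hne hz hcxy ha hb] at ha
  rw [sub_eq_iff_eq_add] at ha
  rw [ha]
  module

end Rigidity

/-! ### Vanishing of the deficit -/

section Deficit

variable {d : ℕ} {μ ν : Measure (EuclideanSpace ℝ (Fin d))}
  {T : EuclideanSpace ℝ (Fin d) → EuclideanSpace ℝ (Fin d)}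

lemma IsBrenierMap.W2sq_eq (hT : IsBrenierMap μ ν T) (hμ : IsP2 μ) (hν : IsP2 ν) :
    W2sq μ ν = ∫⁻ x, ‖x - T x‖ₑ ^ 2 ∂μ := by
  obtain ⟨Ω, φ, hΩ, hφ, h⟩ := hT.exists_convex_potential
  exact W2sq_eq_lintegral_of_subgradient hμ hν hT.aemeasurable hT.map_eq hΩ.measurableSet
    (hφ.continuousOn hΩ)
    (h.mono fun x hx => ⟨hx.1, fun z hz => add_inner_le_of_hasGradientAt hφ hx.1 hz hx.2⟩)

lemma IsBrenierMap.congr {T' : EuclideanSpace ℝ (Fin d) → EuclideanSpace ℝ (Fin d)}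
    (hT : IsBrenierMap μ ν T) (h : T =ᵐ[μ] T') : IsBrenierMap μ ν T' where
  aemeasurable := hT.aemeasurable.congr h
  map_eq := (Measure.map_congr h).symm.trans hT.map_eq
  exists_convex_potential := by
    obtain ⟨Ω, φ, hΩ, hφ, hx⟩ := hT.exists_convex_potential
    refine ⟨Ω, φ, hΩ, hφ, ?_⟩
    filter_upwards [hx, h] with x hx hxT
    rwa [← hxT]

lemma measurable_inner_left (θ : EuclideanSpace ℝ (Fin d)) :
    Measurable fun x : EuclideanSpace ℝ (Fin d) => ⟪θ, x⟫ := by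
  have : Continuous fun x : EuclideanSpace ℝ (Fin d) => ⟪θ, x⟫ := by fun_prop
  exact this.measurable

lemma enorm_inner_sq_le (θ v : EuclideanSpace ℝ (Fin d)) :
    ‖⟪θ, v⟫‖ₑ ^ 2 ≤ ‖θ‖ₑ ^ 2 * ‖v‖ₑ ^ 2 := by
  rw [← mul_pow]
  gcongr
  rw [← ofReal_norm, ← ofReal_norm, ← ofReal_norm, ← ENNReal.ofReal_mul (norm_nonneg _)]
  exact ENNReal.ofReal_le_ofReal (norm_inner_le_norm θ v)

lemma IsP2.proj (hμ : IsP2 μ) (θ : EuclideanSpace ℝ (Fin d)) : IsP2 (proj θ μ) := by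
  have := hμ.isProbabilityMeasure
  refine ⟨Measure.isProbabilityMeasure_map (measurable_inner_left θ).aemeasurable, ?_⟩
  rw [SlicedWasserstein.proj, lintegral_map (by fun_prop) (measurable_inner_left θ)]
  calc ∫⁻ x, ‖⟪θ, x⟫‖ₑ ^ 2 ∂μ ≤ ∫⁻ x, ‖θ‖ₑ ^ 2 * ‖x‖ₑ ^ 2 ∂μ := by
        exact lintegral_mono fun x => enorm_inner_sq_le θ x
    _ = ‖θ‖ₑ ^ 2 * ∫⁻ x, ‖x‖ₑ ^ 2 ∂μ := lintegral_const_mul _ (by fun_prop)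
    _ < ∞ := ENNReal.mul_lt_top (by simp) hμ.secondMoment_lt_top

lemma proj_map (hTm : Measurable T) (θ : EuclideanSpace ℝ (Fin d)) :
    proj θ (μ.map T) = μ.map fun x => ⟪θ, T x⟫ :=
  Measure.map_map (measurable_inner_left θ) hTm

lemma lintegral_enorm_sub_sq_ne_top (hμ : IsP2 μ) (hν : IsP2 ν) (hTm : Measurable T) (hTν : μ.map T = ν) :
    ∫⁻ x, ‖x - T x‖ₑ ^ 2 ∂μ ≠ ∞ := by
  have hT2 : MemLp T 2 μ := (memLp_map_measure_iff (g := fun y => y)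
    aestronglyMeasurable_id hTm.aemeasurable).1 (hTν ▸ hν.memLp_id)
  have := (hμ.memLp_id.sub hT2).2
  rw [eLpNorm_lt_top_iff_lintegral_rpow_enorm_lt_top (by norm_num) (by norm_num)] at this
  simpa using this.ne

/-- When `T` is an optimal map, the deficit integrates over `θ` the gap between the cost of the
coupling `(θ · x, θ · T x)` and the optimal cost, so it vanishes if and only if almost all of
these one-dimensional couplings are optimal. -/
theorem deficit_eq_zero_iff (hd : d ≠ 0) (hμ : IsP2 μ) (hν : IsP2 ν) (hTm : Measurable T)
    (hTν : μ.map T = ν) (hW : W2sq μ ν = ∫⁻ x, ‖x - T x‖ₑ ^ 2 ∂μ) :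
    deficit μ ν = 0 ↔ ∀ᵐ θ ∂sphereUniform d,
      W2sq (proj θ.1 μ) (proj θ.1 ν) = ∫⁻ x, ‖⟪θ.1, x⟫ - ⟪θ.1, T x⟫‖ₑ ^ 2 ∂μ := by
  have := hμ.isProbabilityMeasure
  have := isProbabilityMeasure_sphereUniform hd
  have hmeas : Measurable (Function.uncurry fun
      (θ : Metric.sphere (0 : EuclideanSpace ℝ (Fin d)) 1) (x : EuclideanSpace ℝ (Fin d)) =>
      ‖⟪θ.1, x⟫ - ⟪θ.1, T x⟫‖ₑ ^ 2) := by
    simp only [Function.uncurry_def]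
    fun_prop
  have hI : ∫⁻ θ, ∫⁻ x, ‖⟪θ.1, x⟫ - ⟪θ.1, T x⟫‖ₑ ^ 2 ∂μ ∂(sphereUniform d) =
      (W2sq μ ν) / d := by
    rw [lintegral_lintegral_swap hmeas.aemeasurable, hW]
    simp_rw [← inner_sub_right, lintegral_enorm_inner_sq hd, div_eq_mul_inv]
    exact lintegral_mul_const _ (by fun_prop)
  have hle : ∀ θ : EuclideanSpace ℝ (Fin d), W2sq (proj θ μ) (proj θ ν) ≤
      ∫⁻ x, ‖⟪θ, x⟫ - ⟪θ, T x⟫‖ₑ ^ 2 ∂μ := by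
    intro θ
    rw [← hTν, proj_map hTm]
    exact W2sq_map_le (measurable_inner_left θ).aemeasurable (by fun_prop)
  have hSW : SW2sq μ ν ≤ (W2sq μ ν) / d := hI ▸ lintegral_mono fun θ => hle θ
  have hfin : (W2sq μ ν) / d ≠ ∞ :=
    ENNReal.div_ne_top (hW ▸ lintegral_enorm_sub_sq_ne_top hμ hν hTm hTν) (by exact_mod_cast hd)
  have hSWfin : SW2sq μ ν ≠ ∞ := ne_top_of_le_ne_top hfin hSW
  have hdef : deficit μ ν = 0 ↔ SW2sq μ ν = (W2sq μ ν) / d := by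
    rw [← ENNReal.toReal_eq_toReal_iff' hSWfin hfin, deficit, sub_eq_zero, ENNReal.toReal_div,
      ENNReal.toReal_natCast, one_div_mul_eq_div, eq_comm]
  rw [hdef]
  constructor
  · intro h
    -- the integrand of `SW2sq` need not be measurable here: it lies below a measurable function
    exact ae_eq_of_ae_le_of_lintegral_le (.of_forall fun θ => hle θ) hSWfin
      hmeas.lintegral_prod_right.aemeasurable (hI.trans h.symm).le
  · intro h
    rw [← hI]
    exact lintegral_congr_ae h

/-- Optimality of the projected couplings in almost all directions forces the increments of `T` to
be parallel to the increments of the points. -/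
lemma ae_parallel_of_proj_optimal (hd : d ≠ 0) (hμ : IsP2 μ) (hν : IsP2 ν) (hTm : Measurable T)
    (hTν : μ.map T = ν) (h : ∀ᵐ θ ∂sphereUniform d,
      W2sq (proj θ.1 μ) (proj θ.1 ν) = ∫⁻ x, ‖⟪θ.1, x⟫ - ⟪θ.1, T x⟫‖ₑ ^ 2 ∂μ) :
    ∀ᵐ x ∂μ, ∀ᵐ y ∂μ, x ≠ y → ∃ c : ℝ, 0 ≤ c ∧ T x - T y = c • (x - y) := by
  have := hμ.isProbabilityMeasure
  have := isProbabilityMeasure_sphereUniform hd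
  have := isOpenPosMeasure_sphereUniform (d := d)
  have hmono : ∀ᵐ θ ∂sphereUniform d, ∀ᵐ q ∂μ.prod μ,
      0 ≤ ⟪θ.1, q.1 - q.2⟫ * ⟪θ.1, T q.1 - T q.2⟫ := by
    filter_upwards [h] with θ hθ
    have hθT : Measurable fun x => ⟪θ.1, T x⟫ := (measurable_inner_left θ.1).comp hTm
    have hpair : Measurable fun x => (⟪θ.1, x⟫, ⟪θ.1, T x⟫) :=
      (measurable_inner_left θ.1).prodMk hθT
    have hcoup : IsCoupling (μ.map fun x => (⟪θ.1, x⟫, ⟪θ.1, T x⟫)) (proj θ.1 μ)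
        (proj θ.1 ν) := by
      rw [← hTν, proj_map hTm]
      exact isCoupling_map (measurable_inner_left θ.1).aemeasurable hθT.aemeasurable
    have hcost : ∫⁻ p, ‖p.1 - p.2‖ₑ ^ 2 ∂(μ.map fun x => (⟪θ.1, x⟫, ⟪θ.1, T x⟫)) =
        ∫⁻ x, ‖⟪θ.1, x⟫ - ⟪θ.1, T x⟫‖ₑ ^ 2 ∂μ :=
      lintegral_map measurable_enorm_sub_sq hpair
    have hfin : ∫⁻ x, ‖⟪θ.1, x⟫ - ⟪θ.1, T x⟫‖ₑ ^ 2 ∂μ ≠ ∞ := by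
      refine ne_top_of_le_ne_top (lintegral_enorm_sub_sq_ne_top hμ hν hTm hTν) (lintegral_mono fun x => ?_)
      rw [← inner_sub_right]
      refine (enorm_inner_sq_le θ.1 _).trans ?_
      have : ‖θ.1‖ₑ = 1 := by rw [← ofReal_norm]; simp
      rw [this, one_pow, one_mul]
    have := Measure.isProbabilityMeasure_map (μ := μ) hpair.aemeasurable
    have hae := ae_inner_nonneg_of_optimal hcoup (hcost.trans hθ.symm).le (hcost ▸ hfin)
    rw [Measure.map_prod_map _ _ hpair hpair] at hae
    filter_upwards [ae_of_ae_map (by fun_prop) hae] with q hq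
    simp only [Prod.map_fst, Prod.map_snd, ← inner_sub_right] at hq
    rw [mul_comm]
    simpa using hq
  have hset : MeasurableSet {z : Metric.sphere (0 : EuclideanSpace ℝ (Fin d)) 1 ×
      (EuclideanSpace ℝ (Fin d) × EuclideanSpace ℝ (Fin d)) |
      0 ≤ ⟪z.1.1, z.2.1 - z.2.2⟫ * ⟪z.1.1, T z.2.1 - T z.2.2⟫} :=
    measurableSet_le measurable_const (by fun_prop)
  refine Measure.ae_ae_of_ae_prod (μ := μ) (ν := μ) (p := fun q => q.1 ≠ q.2 →
    ∃ c : ℝ, 0 ≤ c ∧ T q.1 - T q.2 = c • (q.1 - q.2)) ?_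
  filter_upwards [(Measure.ae_ae_comm hset).1 hmono] with q hq hne
  refine exists_eq_smul_of_inner_mul_inner_nonneg (sub_ne_zero.2 hne) fun θ hθ => ?_
  -- by continuity, the inequality for almost all unit vectors holds for all of them
  by_contra! hneg
  have hopen : IsOpen {θ : Metric.sphere (0 : EuclideanSpace ℝ (Fin d)) 1 |
      ⟪θ.1, q.1 - q.2⟫ * ⟪θ.1, T q.1 - T q.2⟫ < 0} :=
    isOpen_lt (by fun_prop) continuous_const
  refine (hopen.measure_ne_zero (sphereUniform d) ⟨⟨θ, by simpa using hθ⟩, hneg⟩) ?_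
  rw [measure_eq_zero_iff_ae_notMem]
  filter_upwards [hq] with η hη using not_lt.2 hη

/-- An affine dilation projects to affine nondecreasing maps of the line, which are optimal. -/
lemma W2sq_proj_of_eq_smul_add (hμ : IsP2 μ) (hν : IsP2 ν) (hTm : Measurable T)
    (hTν : μ.map T = ν) {l : ℝ} (hl : 0 ≤ l) {b : EuclideanSpace ℝ (Fin d)}
    (hT : ∀ᵐ x ∂μ, T x = l • x + b) (θ : EuclideanSpace ℝ (Fin d)) :
    W2sq (proj θ μ) (proj θ ν) = ∫⁻ x, ‖⟪θ, x⟫ - ⟪θ, T x⟫‖ₑ ^ 2 ∂μ := by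
  set S : ℝ → ℝ := fun s => l * s + ⟪θ, b⟫
  have hTS : (fun x => ⟪θ, T x⟫) =ᵐ[μ] fun x => S ⟪θ, x⟫ := by
    filter_upwards [hT] with x hx
    rw [hx, inner_add_right, real_inner_smul_right]
  have hS : Measurable S := by fun_prop
  have hmap : (proj θ μ).map S = proj θ ν := by
    rw [← hTν, proj_map hTm, Measure.map_congr hTS, proj,
      Measure.map_map hS (measurable_inner_left θ)]
    rfl
  rw [W2sq_eq_lintegral_of_subgradient (hμ.proj θ) (hν.proj θ) hS.aemeasurable hmap
    (Ω := univ) (φ := fun s => l * s ^ 2 / 2 + ⟪θ, b⟫ * s) MeasurableSet.univ (by fun_prop) ?_]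
  · rw [proj, lintegral_map (by fun_prop) (measurable_inner_left θ)]
    refine lintegral_congr_ae ?_
    filter_upwards [hTS] with x hx
    rw [hx]
  · refine .of_forall fun s => ⟨mem_univ s, fun t _ => ?_⟩
    simp only [S, RCLike.inner_apply, conj_trivial]
    nlinarith [mul_nonneg hl (sq_nonneg (t - s))]

end Deficit

end SlicedWasserstein

open SlicedWasserstein in
theorem theorem1p1 (d : ℕ) (hd : 2 ≤ d)
    (μ ν : MeasureTheory.Measure (EuclideanSpace ℝ (Fin d))) 
    (hμ : SlicedWasserstein.IsP2 μ) (hν : SlicedWasserstein.IsP2 ν)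
    (hac : μ.AbsolutelyContinuous MeasureTheory.volume)
    (T : EuclideanSpace ℝ (Fin d) → EuclideanSpace ℝ (Fin d)) (hT : SlicedWasserstein.IsBrenierMap μ ν T) :
    SlicedWasserstein.deficit μ ν = 0 ↔
      ∃ (l : ℝ) (b : EuclideanSpace ℝ (Fin d)), 0 ≤ l ∧ ∀ᵐ x ∂μ, T x = l • x + b := by
  have := hμ.isProbabilityMeasure
  have hd0 : d ≠ 0 := by omega
  set S := hT.aemeasurable.mk T
  have hTS : T =ᵐ[μ] S := hT.aemeasurable.ae_eq_mk
  have hSm : Measurable S := hT.aemeasurable.measurable_mk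
  have hS := hT.congr hTS
  rw [deficit_eq_zero_iff hd0 hμ hν hSm hS.map_eq (hS.W2sq_eq hμ hν)]
  constructor
  · intro h
    obtain ⟨l, b, hl, hlb⟩ := exists_eq_smul_add_of_ae_parallel hac (by simpa using hd)
      (ae_parallel_of_proj_optimal hd0 hμ hν hSm hS.map_eq h)
    refine ⟨l, b, hl, ?_⟩
    filter_upwards [hTS, hlb] with x hx hx'
    rw [hx, hx']
  · rintro ⟨l, b, hl, hlb⟩
    refine .of_forall fun θ => W2sq_proj_of_eq_smul_add hμ hν hSm hS.map_eq hl (b := b) ?_ θ.1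
    filter_upwards [hTS, hlb] with x hx hx'
    rw [← hx, hx']
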